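/- Let $X\subseteq\mathbb{C}$ be a non-empty compact set whose interior $\operatorname{int}X$ is dense in $X$ (so that $X$ has no isolated points), and let $C(X)$ be the set of continuous functions $X\to\mathbb{C}$. A path in $X$ is a continuous map $\gamma:[a,b]\to X$ with real $a<b$; its endpoints are $\gamma^-=\gamma(a)$ and $\gamma^+=\gamma(b)$, and its length $|\gamma|\in[0,\infty]$ is its total variation. It is rectifiable if $|\gamma|<\infty$, and admissible if it is rectifiable and not constant on any non-degenerate closed subinterval of $[a,b]$. Let $\mathcal{F}$ be the set of all admissible paths $\gamma:[a,b]\to X$ in $X$ for which $[a,b]\setminus\gamma^{-1}(\operatorname{int}X)$ is countable. Define three subsets of $C(X)$: - $D^{(1)}_{\mathcal F}(X)$ is the set of $f\in C(X)$ for which there is $g\in C(X)$ such that $\int_\gamma g(z)\,\mathrm{d}z=f(\gamma^+)-f(\gamma^-)$ (a Riemann–Stieltjes integral) for all $\gamma\in\mathcal F$; - $A^{(1)}(X)$ is the set of $f\in C(X)$ that are analytic on $\operatorname{int}X$ and are such that $(f|_{\operatorname{int}X})'$ extends to a continuous function on $X$; - $D^{(1)}(X)$ is the set of $f\in C(X)$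 such that $f'(x)=\lim_{z\to x,\;z\in X\setminus\{x\}}\frac{f(z)-f(x)}{z-x}$ exists for every $x\in X$ and $f'$ is continuous on $X$. Then $D^{(1)}_{\mathcal F}(X)=A^{(1)}(X)$. Suppose moreover that $X$ is $\mathcal F$-regular: for each $z\in X$ there is a constant $k_z>0$ such that, for every $w\in X$ with $w\ne z$, there is a path $\gamma\in\mathcal F$ from $z$ to $w$ with $|\gamma|\le k_z|z-w|$. Then both of these sets are equal to $D^{(1)}(X)$. -/

import Mathlib

open Set Filter Topology

noncomputable section

/-- A path in the plane set `X`: a continuous map `[a, b] → X`, where `a < b` are real numbers.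
(A path in `ℂ` with image contained in `X` is the same thing as a continuous map into `X`.) -/
structure PlanePath (X : Set ℂ) where
  /-- left end of the parameter interval -/
  a : ℝ
  /-- right end of the parameter interval -/
  b : ℝ
  /-- the parameter interval is non-degenerate -/
  hab : a < b
  /-- the underlying continuous map -/
  map : C(Set.Icc a b, X)

namespace PlanePath

variable {X : Set ℂ}

/-- The left end of the parameter interval `[a, b]`, as a point of that interval. -/
def left (γ : PlanePath X) : Set.Icc γ.a γ.b := ⟨γ.a, le_rfl, γ.hab.le⟩

/-- The right end of the parameter interval `[a, b]`, as a point of that interval. -/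
def right (γ : PlanePath X) : Set.Icc γ.a γ.b := ⟨γ.b, γ.hab.le, le_rfl⟩

/-- The initial endpoint `γ⁻ = γ(a)`. -/
def source (γ : PlanePath X) : X := γ.map γ.left

/-- The final endpoint `γ⁺ = γ(b)`. -/
def target (γ : PlanePath X) : X := γ.map γ.right

/-- The subpath of `γ` obtained by restriction to `[c, d] ⊆ [a, b]`, where `c < d`. -/
def subpath (γ : PlanePath X) (c d : ℝ) (hc : γ.a ≤ c) (hcd : c < d) (hd : d ≤ γ.b) :
    PlanePath X where
  a := c
  b := d
  hab := hcd
  map := γ.map.comp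
    ⟨Set.inclusion (Set.Icc_subset_Icc hc hd), continuous_inclusion (Set.Icc_subset_Icc hc hd)⟩

/-- The length of a path: its total variation, which is `∞` if the path is not rectifiable. -/
def length (γ : PlanePath X) : ENNReal :=
  eVariationOn (fun t : Set.Icc γ.a γ.b => (γ.map t : ℂ)) Set.univ

/-- A path is rectifiable if it has finite length. -/
def Rectifiable (γ : PlanePath X) : Prop := γ.length ≠ ⊤

/-- A path is constant if it takes only one value. -/
def IsConstant (γ : PlanePath X) : Prop := ∀ s t, γ.map s = γ.map t

/-- A path is admissible if it is rectifiable and has no constant subpaths. -/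
def Admissible (γ : PlanePath X) : Prop :=
  γ.Rectifiable ∧
    ∀ (c d : ℝ) (hc : γ.a ≤ c) (hcd : c < d) (hd : d ≤ γ.b), ¬ (γ.subpath c d hc hcd hd).IsConstant

/-- `γ.HasIntegral g I` says that the Riemann–Stieltjes integral `∫_γ g(z) dz` exists and is equal
to `I`: the sums `∑ g(γ(sᵢ)) (γ(tᵢ₊₁) - γ(tᵢ))` over the tagged partitions
`a = t₀ ≤ t₁ ≤ ⋯ ≤ tₙ = b`, `tᵢ ≤ sᵢ ≤ tᵢ₊₁`, converge to `I` as the mesh tends to zero. -/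
def HasIntegral (γ : PlanePath X) (g : C(X, ℂ)) (I : ℂ) : Prop :=
  ∀ ε : ℝ, 0 < ε → ∃ δ : ℝ, 0 < δ ∧
    ∀ (n : ℕ) (t s : ℕ → Set.Icc γ.a γ.b), t 0 = γ.left → t n = γ.right →
      (∀ i < n, t i ≤ s i ∧ s i ≤ t (i + 1)) →
      (∀ i < n, (t (i + 1) : ℝ) - (t i : ℝ) < δ) →
      ‖(∑ i ∈ Finset.range n, g (γ.map (s i)) * ((γ.map (t (i + 1)) : ℂ) - (γ.map (t i) : ℂ))) - I‖
        < ε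

end PlanePath

/-- `g` is an `F`-derivative of `f`: for every path `γ` in `F`, `∫_γ g = f(γ⁺) - f(γ⁻)`. -/
def IsPathDerivative {X : Set ℂ} (F : Set (PlanePath X)) (f g : C(X, ℂ)) : Prop :=
  ∀ γ ∈ F, γ.HasIntegral g (f γ.target - f γ.source)

/-- `D_F^{(1)}(X)`: the functions in `C(X)` that have an `F`-derivative in `C(X)`. -/
def pathDiff {X : Set ℂ} (F : Set (PlanePath X)) : Set C(X, ℂ) :=
  {f | ∃ g : C(X, ℂ), IsPathDerivative F f g}

/-- `f'(x) = d`, that is, `(f(z) - f(x)) / (z - x) → d` as `z → x` within `X`, `z ≠ x`. -/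
def HasDerivOnSet {X : Set ℂ} (f : C(X, ℂ)) (d : ℂ) (x : X) : Prop :=
  Tendsto (fun z : X => (f z - f x) / ((z : ℂ) - (x : ℂ))) (𝓝[≠] x) (𝓝 d)

/-- `D^{(1)}(X)`: the functions that are complex differentiable at every point of `X`, with a
derivative that is continuous on `X`. -/
def stdDiff (X : Set ℂ) : Set C(X, ℂ) :=
  {f | ∃ g : C(X, ℂ), ∀ x : X, HasDerivOnSet f (g x) x}

open Classical in
/-- The extension by zero of a function on `X` to the plane (only its restriction to the interior
of `X` is ever used). -/
def extendZero {X : Set ℂ} (f : C(X, ℂ)) : ℂ → ℂ := fun z => if h : z ∈ X then f ⟨z, h⟩ else 0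

/-- `A(X)`: the continuous functions on `X` that are analytic on the interior of `X`. -/
def analyticInterior (X : Set ℂ) : Set C(X, ℂ) :=
  {f | AnalyticOnNhd ℂ (extendZero f) (interior X)}

/-- `A^{(1)}(X)`: the functions `f` in `A(X)` such that the derivative of `f` on the interior of `X`
extends to a continuous function on `X`. -/
def analyticDiff (X : Set ℂ) : Set C(X, ℂ) :=
  {f | f ∈ analyticInterior X ∧
    ∃ g : C(X, ℂ), ∀ z (hz : z ∈ interior X), deriv (extendZero f) z = g ⟨z, interior_subset hz⟩}

/-- `X` is `F`-regular: for each `z ∈ X` there is `k > 0` such that every point `w ≠ z` of `X` is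
joined to `z` by a path in `F` of length at most `k |z - w|`. -/
def PathRegular {X : Set ℂ} (F : Set (PlanePath X)) : Prop :=
  ∀ z : X, ∃ k : ℝ, 0 < k ∧ ∀ w : X, w ≠ z →
    ∃ γ ∈ F, γ.source = z ∧ γ.target = w ∧
      γ.length ≤ ENNReal.ofReal (k * ‖(z : ℂ) - (w : ℂ)‖)

/-- The admissible paths `γ` in `X` such that the complement of `γ⁻¹(int X)` in the parameter
interval of `γ` is countable. -/
def mostlyInteriorPaths (X : Set ℂ) : Set (PlanePath X) :=
  {γ | γ.Admissible ∧ {t | (γ.map t : ℂ) ∉ interior X}.Countable}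

end

/-!
The two inclusions between the path derivative and the derivative on the interior rest on different
facts.

A path derivative is an honest derivative wherever short paths reach every nearby point: if `g` is
an `F`-derivative of `f`, and every `w` near `x` is joined to `x` by a path in `F` of length at most
`k |x - w|`, then that path stays where `g` is close to `g x`, so its Riemann sums, hence
`f w - f x`, differ from `g x * (w - x)` by `o(|w - x|)`. This is `IsPathDerivative.hasDerivOnSet`.
At an interior point the paths can be taken to be segments, with `k = 1`, which puts every function
of `D_F^{(1)}(X)` into `A^{(1)}(X)`; under `F`-regularity such paths exist at every point of `X`,
which puts it into `D^{(1)}(X)`. The inclusion of `D^{(1)}(X)` in `A^{(1)}(X)` is immediate.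

Conversely, let `f` have derivative `g` on the interior, and let `γ` be a rectifiable path that
lies in the interior except at countably many times. Whenever `g ∘ γ` is within `ε` of a constant
`l` on `[c, d]`, the function `f ∘ γ - l γ` grows on `[c, d]` at most as fast as `ε` times the arc
length of `γ`. This is clear near every time at which `γ` is in the interior, and
`norm_sub_le_of_eventually_norm_sub_le_off_countable`, a mean value inequality relative to a
monotone function that ignores a countable set, gives the global statement. As `g ∘ γ` is uniformly
continuous, summing over a fine tagged partition with `l = g (γ (sᵢ))` bounds the distance between
the Riemann sum and `f(γ⁺) - f(γ⁻)` by `ε |γ|`, so that the integral exists and has the required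
value.
-/

/-! ### A mean value inequality with a countable exceptional set -/

/-- If a continuous `G` grows to the right of every point of `[c, d)` at most as fast as the
monotone function `M`, then it does so on all of `[c, d]`. -/
theorem norm_sub_le_of_forall_eventually_norm_sub_le {E : Type*} [NormedAddCommGroup E]
    {G : ℝ → E} {M : ℝ → ℝ} (hG : Continuous G) (hM : Monotone M) {c d : ℝ} (hcd : c ≤ d)
    (h : ∀ t ∈ Ico c d, ∀ᶠ s in 𝓝[>] t, ‖G s - G t‖ ≤ M s - M t) :
    ‖G d - G c‖ ≤ M d - M c := by
  set S : Set ℝ := {s | s ∈ Icc c d ∧ ‖G s - G c‖ ≤ M s - M c} with hS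
  have hcS : c ∈ S := ⟨⟨le_rfl, hcd⟩, by simp⟩
  have hbdd : BddAbove S := ⟨d, fun s hs => hs.1.2⟩
  have hle : ∀ s ∈ S, s ≤ sSup S := fun s hs => le_csSup hbdd hs
  have hcσ : c ≤ sSup S := hle c hcS
  have hσd : sSup S ≤ d := csSup_le ⟨c, hcS⟩ fun s hs => hs.1.2
  -- `M` is monotone, so the bound at the points of `S` passes to their supremum.
  have hσ : ‖G (sSup S) - G c‖ ≤ M (sSup S) - M c := by
    have hclosed : IsClosed {x | ‖G x - G c‖ ≤ M (sSup S) - M c} :=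
      isClosed_le (by fun_prop) continuous_const
    exact closure_minimal (fun s hs => hs.2.trans (sub_le_sub_right (hM (hle s hs)) _)) hclosed
      (csSup_mem_closure ⟨c, hcS⟩ hbdd)
  rcases hσd.eq_or_lt with heq | hlt
  · rwa [heq] at hσ
  · obtain ⟨s, hs, hσs, hsd⟩ := ((h _ ⟨hcσ, hlt⟩).and (Ioo_mem_nhdsGT hlt)).exists
    have hsS : s ∈ S := by
      refine ⟨⟨hcσ.trans hσs.le, hsd.le⟩, ?_⟩
      have := norm_sub_le_norm_sub_add_norm_sub (G s) (G (sSup S)) (G c)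
      linarith
    exact absurd (hle s hsS) (not_le.2 hσs)

/-- A countable set supports arbitrarily small jump functions: monotone functions, with values in
`[0, η]`, that jump at every point of the set. -/
theorem Set.Countable.exists_monotone_jump {N : Set ℝ} (hN : N.Countable) {η : ℝ} (hη : 0 < η) :
    ∃ J : ℝ → ℝ, Monotone J ∧ (∀ s, 0 ≤ J s ∧ J s ≤ η) ∧
      ∀ t ∈ N, ∃ w > 0, ∀ s, t < s → w ≤ J s - J t := by
  classical
  obtain ⟨w, hw, c, hc, hcη⟩ := hN.exists_pos_hasSum_le hη
  set u : ℝ → N → ℝ := fun s i => if (i : ℝ) < s then w i else 0 with hu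
  have hu0 : ∀ s i, 0 ≤ u s i := fun s i => by
    simp only [hu]; split_ifs
    exacts [(hw _).le, le_rfl]
  have huw : ∀ s i, u s i ≤ w i := fun s i => by
    simp only [hu]; split_ifs
    exacts [le_rfl, (hw _).le]
  have hsum : ∀ s, Summable (u s) := fun s => hc.summable.of_nonneg_of_le (hu0 s) (huw s)
  have hmono : ∀ s t, s ≤ t → ∀ i, u s i ≤ u t i := fun s t hst i => by
    simp only [hu]; split_ifs with h₁ h₂
    exacts [le_rfl, absurd (h₁.trans_le hst) h₂, (hw _).le, le_rfl]
  -- `J s` is the total weight of the points of `N` to the left of `s`.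
  refine ⟨fun s => ∑' i, u s i, fun s t hst => (hsum s).tsum_le_tsum (hmono s t hst) (hsum t),
    fun s => ⟨tsum_nonneg (hu0 s), ?_⟩, fun t ht => ⟨w t, hw t, fun s hs => ?_⟩⟩
  · exact ((hsum s).tsum_le_tsum (huw s) hc.summable).trans (hc.tsum_eq.trans_le hcη)
  · rw [← (hsum s).tsum_sub (hsum t)]
    have := ((hsum s).sub (hsum t)).le_tsum ⟨t, ht⟩
      fun i _ => sub_nonneg.2 (hmono t s hs.le i)
    simpa [hu, hs] using this

/-- The mean value inequality relative to a monotone function `M`, with a countable exceptional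
set: adding to `M` a small function that jumps at the exceptional points absorbs them, because `G`
is continuous there. -/
theorem norm_sub_le_of_eventually_norm_sub_le_off_countable {E : Type*} [NormedAddCommGroup E]
    {G : ℝ → E} {M : ℝ → ℝ} (hG : Continuous G) (hM : Monotone M) {N : Set ℝ}
    (hN : N.Countable) {c d : ℝ} (hcd : c ≤ d)
    (h : ∀ t ∈ Ico c d, t ∉ N → ∀ᶠ s in 𝓝[>] t, ‖G s - G t‖ ≤ M s - M t) :
    ‖G d - G c‖ ≤ M d - M c := by
  refine le_of_forall_pos_le_add fun η hη => ?_
  obtain ⟨J, hJ, hJη, hjump⟩ := hN.exists_monotone_jump hη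
  have key := norm_sub_le_of_forall_eventually_norm_sub_le (M := fun s => M s + J s) hG
    (hM.add hJ) hcd fun t ht => ?_
  · have := (hJη d).2
    have := (hJη c).1
    linarith
  · by_cases htN : t ∈ N
    · obtain ⟨w, hw, hwJ⟩ := hjump t htN
      have hnear : ∀ᶠ s in 𝓝[>] t, ‖G s - G t‖ < w := by
        have : Tendsto (fun s => ‖G s - G t‖) (𝓝 t) (𝓝 0) := by
          have hc : Continuous fun s => ‖G s - G t‖ := by fun_prop
          simpa using hc.tendsto t
        exact nhdsWithin_le_nhds (this.eventually_lt_const hw)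
      filter_upwards [hnear, self_mem_nhdsWithin] with s hs hts
      have := hwJ s hts
      have := hM (le_of_lt hts)
      linarith
    · filter_upwards [h t ht htN, self_mem_nhdsWithin] with s hs hts
      have := hJ (le_of_lt hts)
      linarith

/-! ### Riemann sums along paths -/

namespace PlanePath

variable {X : Set ℂ}

theorem sum_norm_sub_le_length (γ : PlanePath X) (hγ : γ.Rectifiable) (n : ℕ)
    {t : ℕ → Set.Icc γ.a γ.b} (ht : ∀ i < n, t i ≤ t (i + 1)) :
    ∑ i ∈ Finset.range n, ‖(γ.map (t (i + 1)) : ℂ) - γ.map (t i)‖ ≤ γ.length.toReal := by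
  have hmono : MonotoneOn t (Set.Iic n) := by
    refine monotoneOn_of_le_succ Set.ordConnected_Iic fun i _ _ hi => ?_
    exact ht i (Nat.lt_of_succ_le hi)
  have h := eVariationOn.sum_le_of_monotoneOn_Iic
    (f := fun t : Set.Icc γ.a γ.b => (γ.map t : ℂ)) (s := Set.univ) hmono fun _ _ => Set.mem_univ _
  have h' := ENNReal.toReal_mono hγ h
  rw [ENNReal.toReal_sum fun i _ => edist_ne_top _ _] at h'
  simpa only [← dist_edist, dist_eq_norm] using h'

/-- The uniform partitions show that there are tagged partitions of arbitrarily small mesh. -/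
theorem exists_partition (γ : PlanePath X) {δ : ℝ} (hδ : 0 < δ) :
    ∃ (n : ℕ) (t : ℕ → Set.Icc γ.a γ.b), t 0 = γ.left ∧ t n = γ.right ∧
      (∀ i < n, t i ≤ t (i + 1)) ∧ ∀ i < n, (t (i + 1) : ℝ) - (t i : ℝ) < δ := by
  have hab := γ.hab
  obtain ⟨m, hm⟩ := exists_nat_gt ((γ.b - γ.a) / δ)
  have hm0 : (0 : ℝ) < m := (div_pos (sub_pos.2 hab) hδ).trans hm
  have hstep : (γ.b - γ.a) / m < δ := by
    rw [div_lt_iff₀ hδ] at hm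
    rw [div_lt_iff₀ hm0]; linarith
  have hstep0 : 0 < (γ.b - γ.a) / m := div_pos (sub_pos.2 hab) hm0
  have hval : ∀ i : ℕ, i ≤ m →
      (Set.projIcc γ.a γ.b hab.le (γ.a + i * ((γ.b - γ.a) / m)) : ℝ) =
        γ.a + i * ((γ.b - γ.a) / m) := fun i hi => by
    rw [Set.projIcc_of_mem]
    have hi' : (i : ℝ) * ((γ.b - γ.a) / m) ≤ m * ((γ.b - γ.a) / m) := by gcongr
    rw [mul_div_cancel₀ _ hm0.ne'] at hi'
    exact ⟨le_add_of_nonneg_right (by positivity), by linarith⟩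
  refine ⟨m, fun i => Set.projIcc γ.a γ.b hab.le (γ.a + i * ((γ.b - γ.a) / m)), ?_, ?_, ?_, ?_⟩
  · exact Subtype.ext (by simp [left])
  · refine Subtype.ext ?_
    rw [hval m le_rfl, mul_div_cancel₀ _ hm0.ne']
    simp [right]
  · intro i hi
    refine Set.monotone_projIcc _ ?_
    push_cast; linarith
  · intro i hi
    rw [hval i hi.le, hval (i + 1) hi]
    push_cast; linarith

/-- If the values of `g` along `γ` are within `ε` of `l`, then `∫_γ g` is within `ε |γ|` of
`∫_γ l = l (γ⁺ - γ⁻)`. -/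
theorem HasIntegral.norm_sub_le {γ : PlanePath X} (hγ : γ.Rectifiable) {g : C(X, ℂ)} {I : ℂ}
    (hI : γ.HasIntegral g I) {l : ℂ} {ε : ℝ} (hl : ∀ t, ‖g (γ.map t) - l‖ ≤ ε) :
    ‖I - l * ((γ.target : ℂ) - γ.source)‖ ≤ ε * γ.length.toReal := by
  refine le_of_forall_pos_le_add fun η hη => ?_
  obtain ⟨δ, hδ, H⟩ := hI η hη
  obtain ⟨n, t, h0, hn, ht, hmesh⟩ := γ.exists_partition hδ
  have h₁ := H n t t h0 hn (fun i hi => ⟨le_rfl, ht i hi⟩) hmesh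
  have hε : 0 ≤ ε := (norm_nonneg _).trans (hl γ.left)
  have htel : ((γ.target : ℂ) - γ.source) =
      ∑ i ∈ Finset.range n, ((γ.map (t (i + 1)) : ℂ) - γ.map (t i)) := by
    rw [Finset.sum_range_sub (fun i => (γ.map (t i) : ℂ)), h0, hn, target, source]
  have h₂ : ‖∑ i ∈ Finset.range n, g (γ.map (t i)) * ((γ.map (t (i + 1)) : ℂ) - γ.map (t i)) -
      l * ((γ.target : ℂ) - γ.source)‖ ≤ ε * γ.length.toReal := by
    rw [htel, Finset.mul_sum, ← Finset.sum_sub_distrib]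
    calc _ ≤ ∑ i ∈ Finset.range n, ε * ‖(γ.map (t (i + 1)) : ℂ) - γ.map (t i)‖ := by
          refine norm_sum_le_of_le _ fun i _ => ?_
          rw [← sub_mul, norm_mul]
          exact mul_le_mul_of_nonneg_right (hl _) (norm_nonneg _)
      _ ≤ _ := by
          rw [← Finset.mul_sum]
          exact mul_le_mul_of_nonneg_left (γ.sum_norm_sub_le_length hγ n ht) hε
  rw [norm_sub_rev] at h₁
  have := norm_sub_le_norm_sub_add_norm_sub I
    (∑ i ∈ Finset.range n, g (γ.map (t i)) * ((γ.map (t (i + 1)) : ℂ) - γ.map (t i)))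
    (l * ((γ.target : ℂ) - γ.source))
  linarith

theorem norm_sub_source_le_length (γ : PlanePath X) (hγ : γ.Rectifiable) (t : Set.Icc γ.a γ.b) :
    ‖(γ.map t : ℂ) - γ.source‖ ≤ γ.length.toReal := by
  rw [← dist_eq_norm, dist_edist]
  exact ENNReal.toReal_mono hγ (eVariationOn.edist_le
    (fun t : Set.Icc γ.a γ.b => (γ.map t : ℂ)) (Set.mem_univ _) (Set.mem_univ _))

end PlanePath

/-! ### Path derivatives are derivatives at points reached by short paths -/

/-- If all points `w` near `x` are joined to `x` by paths in `F` of length at most `k |x - w|`, then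
an `F`-derivative of `f` is its derivative at `x`. -/
theorem IsPathDerivative.hasDerivOnSet {X : Set ℂ} {F : Set (PlanePath X)} {f g : C(X, ℂ)}
    (hfg : IsPathDerivative F f g) {x : X} {k : ℝ} (hk : 0 < k)
    (hx : ∀ᶠ w in 𝓝[≠] x, ∃ γ ∈ F, γ.source = x ∧ γ.target = w ∧
      γ.length ≤ ENNReal.ofReal (k * ‖(x : ℂ) - w‖)) :
    HasDerivOnSet f (g x) x := by
  rw [HasDerivOnSet, Metric.tendsto_nhds]
  intro ε hε
  have hε' : 0 < ε / (2 * k) := by positivity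
  obtain ⟨r, hr, hgr⟩ := Metric.continuousAt_iff.1 g.continuous.continuousAt (ε / (2 * k)) hε'
  have hnear : ∀ᶠ w in 𝓝[≠] x, w ∈ Metric.ball x (r / k) :=
    nhdsWithin_le_nhds (Metric.ball_mem_nhds x (by positivity))
  filter_upwards [hx, hnear, self_mem_nhdsWithin] with w ⟨γ, hγF, hs, ht, hlen⟩ hwr hwx
  have hwx' : (w : ℂ) - x ≠ 0 := sub_ne_zero.2 fun h => hwx (Subtype.ext h)
  have hpos : 0 < ‖(w : ℂ) - x‖ := norm_pos_iff.2 hwx'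
  rw [norm_sub_rev] at hlen
  have hrect : γ.Rectifiable := ne_top_of_le_ne_top ENNReal.ofReal_ne_top hlen
  have hlen' : γ.length.toReal ≤ k * ‖(w : ℂ) - x‖ :=
    ENNReal.toReal_le_of_le_ofReal (by positivity) hlen
  have hwr' : k * ‖(w : ℂ) - x‖ < r := by
    rw [Metric.mem_ball, Subtype.dist_eq, dist_eq_norm, lt_div_iff₀ hk] at hwr
    linarith
  -- the whole path stays in the ball on which `g` is close to `g x`
  have hg : ∀ t, ‖g (γ.map t) - g x‖ ≤ ε / (2 * k) := fun t => by
    have h := γ.norm_sub_source_le_length hrect t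
    rw [hs, ← dist_eq_norm, ← Subtype.dist_eq] at h
    rw [← dist_eq_norm]
    exact (hgr (h.trans_lt (hlen'.trans_lt hwr'))).le
  have h := (hfg γ hγF).norm_sub_le hrect hg
  rw [hs, ht] at h
  rw [dist_eq_norm]
  have heq : (f w - f x) / ((w : ℂ) - x) - g x =
      (f w - f x - g x * ((w : ℂ) - x)) / ((w : ℂ) - x) := by
    field_simp
  rw [heq, norm_div, div_lt_iff₀ hpos]
  calc _ ≤ ε / (2 * k) * γ.length.toReal := h
    _ ≤ ε / (2 * k) * (k * ‖(w : ℂ) - x‖) := by gcongr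
    _ = ε / 2 * ‖(w : ℂ) - x‖ := by field_simp
    _ < ε * ‖(w : ℂ) - x‖ := by gcongr; linarith

/-- The straight path from `z` to `w` in a set that contains the segment. -/
noncomputable def segmentPath {X : Set ℂ} (z w : ℂ) (h : segment ℝ z w ⊆ X) : PlanePath X where
  a := 0
  b := 1
  hab := one_pos
  map := ⟨fun t => ⟨AffineMap.lineMap z w (t : ℝ),
    h (by rw [segment_eq_image_lineMap]; exact ⟨t, t.2, rfl⟩)⟩, by
      refine Continuous.subtype_mk ?_ _
      simp only [AffineMap.lineMap_apply]
      fun_prop⟩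

theorem segmentPath_length_le {X : Set ℂ} (z w : ℂ) (h : segment ℝ z w ⊆ X) :
    (segmentPath z w h).length ≤ ENNReal.ofReal ‖z - w‖ := by
  have hlip : LipschitzWith (nndist z w) (AffineMap.lineMap z w : ℝ → ℂ) :=
    lipschitzWith_lineMap z w
  have hid : eVariationOn (fun t : Set.Icc (0 : ℝ) 1 => (t : ℝ)) Set.univ ≤ 1 := by
    have := MonotoneOn.eVariationOn_eq (f := fun t : Set.Icc (0 : ℝ) 1 => (t : ℝ))
      (s := Set.univ) (fun s _ t _ hst => hst) (a := ⟨0, by simp⟩) (b := ⟨1, by simp⟩)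
      (Set.mem_univ _) (Set.mem_univ _)
    refine (eVariationOn.mono _ fun t _ => ?_).trans (this.le.trans (by simp))
    exact ⟨trivial, t.2.1, t.2.2⟩
  have := (hlip.lipschitzOnWith (s := Set.univ)).comp_eVariationOn_le
    (g := fun t : Set.Icc (0 : ℝ) 1 => (t : ℝ)) (s := Set.univ) fun _ _ => Set.mem_univ _
  calc (segmentPath z w h).length ≤ nndist z w * 1 := this.trans (by gcongr)
    _ = ENNReal.ofReal ‖z - w‖ := by
      rw [mul_one, ← dist_eq_norm, ← edist_dist, edist_nndist]

theorem segmentPath_mem_mostlyInteriorPaths {X : Set ℂ} {z w : ℂ} (hzw : z ≠ w)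
    (h : segment ℝ z w ⊆ interior X) :
    segmentPath z w (h.trans interior_subset) ∈ mostlyInteriorPaths X := by
  refine ⟨⟨ne_top_of_le_ne_top ENNReal.ofReal_ne_top (segmentPath_length_le _ _ _),
    fun c d hc hcd hd hconst => ?_⟩, ?_⟩
  · have h₁ := congrArg Subtype.val (hconst ⟨c, le_rfl, hcd.le⟩ ⟨d, hcd.le, le_rfl⟩)
    exact hcd.ne (AffineMap.lineMap_injective ℝ hzw h₁)
  · convert Set.countable_empty
    refine Set.eq_empty_of_forall_notMem fun t ht => ht (h ?_)
    exact (segment_eq_image_lineMap ℝ z w).ge ⟨t, t.2, rfl⟩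

/-! ### Derivatives on the interior -/

theorem extendZero_apply {X : Set ℂ} (f : C(X, ℂ)) (x : X) : extendZero f x = f x := by
  simp [extendZero]

/-- At an interior point, differentiability relative to `X` is ordinary complex
differentiability. -/
theorem HasDerivOnSet.hasDerivAt {X : Set ℂ} {f : C(X, ℂ)} {d : ℂ} {x : X}
    (h : HasDerivOnSet f d x) (hx : (x : ℂ) ∈ interior X) : HasDerivAt (extendZero f) d x := by
  have hX : X ∈ 𝓝 (x : ℂ) := mem_interior_iff_mem_nhds.1 hx
  refine HasDerivWithinAt.hasDerivAt (s := X) ?_ hX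
  have himg : ((↑) : X → ℂ) '' {x}ᶜ = X \ {(x : ℂ)} := by
    ext z
    simp [and_comm]
  rw [hasDerivWithinAt_iff_tendsto_slope, ← himg,
    ← IsEmbedding.subtypeVal.map_nhdsWithin_eq, tendsto_map'_iff]
  refine h.congr fun z => ?_
  simp [slope_def_field, extendZero_apply]

theorem mem_analyticDiff_of_hasDerivOnSet {X : Set ℂ} {f g : C(X, ℂ)}
    (h : ∀ x : X, (x : ℂ) ∈ interior X → HasDerivOnSet f (g x) x) : f ∈ analyticDiff X := by
  have h' : ∀ z (hz : z ∈ interior X),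
      HasDerivAt (extendZero f) (g ⟨z, interior_subset hz⟩) z :=
    fun z hz => (h ⟨z, interior_subset hz⟩ hz).hasDerivAt hz
  refine ⟨DifferentiableOn.analyticOnNhd (fun z hz => ?_) isOpen_interior, g,
    fun z hz => (h' z hz).deriv⟩
  exact (h' z hz).differentiableAt.differentiableWithinAt

theorem stdDiff_subset_analyticDiff (X : Set ℂ) : stdDiff X ⊆ analyticDiff X :=
  fun _ ⟨_, hg⟩ => mem_analyticDiff_of_hasDerivOnSet fun x _ => hg x

theorem pathDiff_subset_analyticDiff (X : Set ℂ) :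
    pathDiff (mostlyInteriorPaths X) ⊆ analyticDiff X := by
  rintro f ⟨g, hfg⟩
  refine mem_analyticDiff_of_hasDerivOnSet (g := g) fun x hx => ?_
  refine hfg.hasDerivOnSet one_pos ?_
  obtain ⟨r, hr, hball⟩ := Metric.isOpen_iff.1 isOpen_interior (x : ℂ) hx
  filter_upwards [nhdsWithin_le_nhds (Metric.ball_mem_nhds x hr), self_mem_nhdsWithin]
    with w hw hwx
  have hseg : segment ℝ (x : ℂ) w ⊆ interior X :=
    ((convex_ball (x : ℂ) r).segment_subset (Metric.mem_ball_self hr) hw).trans hball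
  refine ⟨_, segmentPath_mem_mostlyInteriorPaths (fun h => hwx (Subtype.ext h.symm)) hseg,
    Subtype.ext ?_, Subtype.ext ?_, ?_⟩
  · exact AffineMap.lineMap_apply_zero (k := ℝ) (x : ℂ) (w : ℂ)
  · exact AffineMap.lineMap_apply_one (k := ℝ) (x : ℂ) (w : ℂ)
  · simpa using segmentPath_length_le (x : ℂ) w (hseg.trans interior_subset)

theorem pathDiff_subset_stdDiff {X : Set ℂ} {F : Set (PlanePath X)} (hF : PathRegular F) :
    pathDiff F ⊆ stdDiff X := by
  rintro f ⟨g, hfg⟩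
  refine ⟨g, fun x => ?_⟩
  obtain ⟨k, hk, h⟩ := hF x
  exact hfg.hasDerivOnSet hk (eventually_mem_nhdsWithin.mono h)

/-! ### The fundamental theorem of calculus for mostly interior paths -/

namespace PlanePath

variable {X : Set ℂ}

/-- The path, extended to the whole real line by its endpoint values. -/
noncomputable def extend (γ : PlanePath X) (t : ℝ) : X := γ.map (Set.projIcc γ.a γ.b γ.hab.le t)

theorem continuous_extend (γ : PlanePath X) : Continuous γ.extend :=
  γ.map.continuous.comp continuous_projIcc

theorem extend_coe (γ : PlanePath X) (t : Set.Icc γ.a γ.b) : γ.extend t = γ.map t := by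
  rw [extend, Set.projIcc_val]

theorem eVariationOn_extend_le (γ : PlanePath X) :
    eVariationOn (fun t => (γ.extend t : ℂ)) Set.univ ≤ γ.length :=
  eVariationOn.comp_le_of_monotoneOn (fun t : Set.Icc γ.a γ.b => (γ.map t : ℂ))
    (Set.projIcc γ.a γ.b γ.hab.le) ((Set.monotone_projIcc _).monotoneOn _)
    fun _ _ => Set.mem_univ _

/-- A path that lies in the interior of `X` up to countably many times satisfies the mean value
inequality with respect to its arc length `v`. -/
theorem norm_sub_sub_le_of_hasDerivAt (γ : PlanePath X)
    (hint : {t | (γ.map t : ℂ) ∉ interior X}.Countable) {f g : C(X, ℂ)}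
    (hfg : ∀ x : X, (x : ℂ) ∈ interior X → HasDerivAt (extendZero f) (g x) x)
    {v : ℝ → ℝ} (hv : ∀ s t, s ≤ t → ‖(γ.extend t : ℂ) - γ.extend s‖ ≤ v t - v s)
    {l : ℂ} {ε : ℝ} {c d : Set.Icc γ.a γ.b} (hcd : c ≤ d)
    (hl : ∀ t ∈ Set.Icc c d, ‖g (γ.map t) - l‖ < ε) :
    ‖f (γ.map d) - f (γ.map c) - l * ((γ.map d : ℂ) - γ.map c)‖ ≤ ε * (v d - v c) := by
  have hvmono : Monotone v := fun s t hst => sub_nonneg.1 ((norm_nonneg _).trans (hv s t hst))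
  have hε : 0 < ε := (norm_nonneg _).trans_lt (hl c ⟨le_rfl, hcd⟩)
  have hext := γ.continuous_extend
  have key := norm_sub_le_of_eventually_norm_sub_le_off_countable
    (G := fun t => f (γ.extend t) - l * (γ.extend t : ℂ)) (M := fun t => ε * v t)
    (by fun_prop) (hvmono.const_mul hε.le) (hint.image Subtype.val)
    (c := (c : ℝ)) (d := (d : ℝ)) hcd fun t ht htN => ?_
  · simp only [extend_coe] at key
    rw [mul_sub ε]
    refine le_of_eq_of_le (congrArg norm ?_) key
    ring
  · have htmem : t ∈ Set.Icc γ.a γ.b := ⟨c.2.1.trans ht.1, ht.2.le.trans d.2.2⟩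
    have hγt : γ.extend t = γ.map ⟨t, htmem⟩ := γ.extend_coe ⟨t, htmem⟩
    have htint : (γ.extend t : ℂ) ∈ interior X := by
      by_contra hcon
      exact htN ⟨⟨t, htmem⟩, by rwa [hγt] at hcon, rfl⟩
    have hlt : ‖g (γ.extend t) - l‖ < ε := by
      rw [hγt]; exact hl ⟨t, htmem⟩ ⟨ht.1, ht.2.le⟩
    have hlittle := (hasDerivAt_iff_isLittleO.1 (hfg _ htint)).def (sub_pos.2 hlt)
    have htend : Tendsto (fun s => (γ.extend s : ℂ)) (𝓝[>] t) (𝓝 (γ.extend t)) :=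
      ((continuous_subtype_val.comp hext).tendsto t).mono_left nhdsWithin_le_nhds
    filter_upwards [htend.eventually hlittle, self_mem_nhdsWithin] with s hs hts
    simp only [extendZero_apply, smul_eq_mul] at hs
    have hvs := hv t s (le_of_lt hts)
    calc ‖f (γ.extend s) - l * (γ.extend s : ℂ) - (f (γ.extend t) - l * (γ.extend t : ℂ))‖
        = ‖(f (γ.extend s) - f (γ.extend t) -
              ((γ.extend s : ℂ) - γ.extend t) * g (γ.extend t)) +
            (g (γ.extend t) - l) * ((γ.extend s : ℂ) - γ.extend t)‖ := by congr 1; ring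
      _ ≤ (ε - ‖g (γ.extend t) - l‖) * ‖(γ.extend s : ℂ) - γ.extend t‖ +
            ‖g (γ.extend t) - l‖ * ‖(γ.extend s : ℂ) - γ.extend t‖ := by
          refine norm_add_le_of_le hs (norm_mul_le _ _)
      _ = ε * ‖(γ.extend s : ℂ) - γ.extend t‖ := by ring
      _ ≤ ε * (v s - v t) := by gcongr
      _ = ε * v s - ε * v t := mul_sub _ _ _

/-- The fundamental theorem of calculus along a rectifiable path that lies in the interior of `X` up
to countably many times, including the existence of the Riemann–Stieltjes integral. -/
theorem hasIntegral_of_hasDerivAt (γ : PlanePath X) (hγ : γ.Rectifiable)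
    (hint : {t | (γ.map t : ℂ) ∉ interior X}.Countable) {f g : C(X, ℂ)}
    (hfg : ∀ x : X, (x : ℂ) ∈ interior X → HasDerivAt (extendZero f) (g x) x) :
    γ.HasIntegral g (f γ.target - f γ.source) := by
  have hbv : LocallyBoundedVariationOn (fun t => (γ.extend t : ℂ)) Set.univ :=
    BoundedVariationOn.locallyBoundedVariationOn
      (ne_top_of_le_ne_top hγ γ.eVariationOn_extend_le)
  -- `v` is the arc length of the extended path, up to an additive constant.
  set v : ℝ → ℝ := variationOnFromTo (fun t => (γ.extend t : ℂ)) Set.univ 0 with hv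
  have hvle : ∀ s t, s ≤ t → ‖(γ.extend t : ℂ) - γ.extend s‖ ≤ v t - v s := fun s t hst => by
    have hadd := variationOnFromTo.add hbv (a := 0) trivial (Set.mem_univ s) (Set.mem_univ t)
    rw [hv, ← hadd, add_sub_cancel_left, variationOnFromTo.eq_of_le _ _ hst, ← dist_eq_norm]
    exact BoundedVariationOn.dist_le (hbv s t trivial trivial) ⟨trivial, hst, le_rfl⟩
      ⟨trivial, le_rfl, hst⟩
  intro ε hε
  set L := v γ.b - v γ.a with hL
  have hL0 : 0 ≤ L := (norm_nonneg _).trans (hvle _ _ γ.hab.le)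
  -- `L + 1` is positive even if `L = 0`, and makes the final inequality strict.
  have hη : 0 < ε / (L + 1) := by positivity
  obtain ⟨δ, hδ, hunif⟩ := Metric.uniformContinuous_iff.1
    (CompactSpace.uniformContinuous_of_continuous (g.continuous.comp γ.map.continuous)) _ hη
  refine ⟨δ, hδ, fun n t s h0 hn hts hmesh => ?_⟩
  have htel : ∀ F : Set.Icc γ.a γ.b → ℂ, F γ.right - F γ.left =
      ∑ i ∈ Finset.range n, (F (t (i + 1)) - F (t i)) := fun F => by
    rw [Finset.sum_range_sub (fun i => F (t i)), h0, hn]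
  have hLtel : L = ∑ i ∈ Finset.range n, (v (t (i + 1)) - v (t i)) := by
    rw [Finset.sum_range_sub (fun i => v (t i)), h0, hn]; rfl
  rw [target, source, htel fun r => f (γ.map r), ← Finset.sum_sub_distrib]
  calc _ ≤ ∑ i ∈ Finset.range n, ε / (L + 1) * (v (t (i + 1)) - v (t i)) := by
        refine norm_sum_le_of_le _ fun i hi => ?_
        have hi' := Finset.mem_range.1 hi
        rw [norm_sub_rev]
        refine γ.norm_sub_sub_le_of_hasDerivAt hint hfg hvle
          ((hts i hi').1.trans (hts i hi').2) fun r hr => ?_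
        rw [← dist_eq_norm]
        refine hunif ?_
        have h₁ : (t i : ℝ) ≤ s i := (hts i hi').1
        have h₂ : (s i : ℝ) ≤ t (i + 1) := (hts i hi').2
        have h₃ : (t i : ℝ) ≤ r := hr.1
        have h₄ : (r : ℝ) ≤ t (i + 1) := hr.2
        have h₅ := hmesh i hi'
        rw [Subtype.dist_eq, Real.dist_eq, abs_lt]
        constructor <;> linarith
    _ = ε / (L + 1) * L := by rw [← Finset.mul_sum, ← hLtel]
    _ < ε := by
        rw [div_mul_eq_mul_div, div_lt_iff₀ (by positivity)]
        nlinarith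

end PlanePath

theorem analyticDiff_subset_pathDiff (X : Set ℂ) :
    analyticDiff X ⊆ pathDiff (mostlyInteriorPaths X) := by
  rintro f ⟨hf, g, hg⟩
  refine ⟨g, fun γ hγ => γ.hasIntegral_of_hasDerivAt hγ.1.1 hγ.2 fun x hx => ?_⟩
  have := (hf x hx).differentiableAt.hasDerivAt
  rwa [hg x hx] at this

theorem mainTheorem12 (X : Set ℂ) (hXne : X.Nonempty) (hX : IsCompact X)
    (hdense : X ⊆ closure (interior X)) :
    pathDiff (mostlyInteriorPaths X) = analyticDiff X ∧
      (PathRegular (mostlyInteriorPaths X) →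
        pathDiff (mostlyInteriorPaths X) = stdDiff X ∧ analyticDiff X = stdDiff X) := by
  have heq : pathDiff (mostlyInteriorPaths X) = analyticDiff X :=
    (pathDiff_subset_analyticDiff X).antisymm (analyticDiff_subset_pathDiff X)
  refine ⟨heq, fun hreg => ?_⟩
  have hstd : pathDiff (mostlyInteriorPaths X) = stdDiff X :=
    (pathDiff_subset_stdDiff hreg).antisymm (heq ▸ stdDiff_subset_analyticDiff X)
  exact ⟨hstd, heq ▸ hstd⟩
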